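/- **Setting.** Let $X$ be a metric space with distance $d$. A *semiflow* on $X$ is a jointly continuous map $[0,\infty)\times X\to X$, $(t,x)\mapsto\phi^t(x)$, with $\phi^0=\mathrm{id}$ and $\phi^{s+t}=\phi^s\circ\phi^t$. *Chains.* For a map $T:X\to X$ write $x\rightsquigarrow_T y$ if for every continuous $\varepsilon:X\to(0,\infty)$ there are $n\ge 1$ and points $x=x_0,\dots,x_n=y$ with $d(T(x_i),x_{i+1})<\varepsilon(T(x_i))$ for $0\le i<n$. For a semiflow write $x\rightsquigarrow_\phi y$ if for every continuous $\varepsilon:X\to(0,\infty)$ and every $\tau>0$ there are $n\ge1$, points $x=x_0,\dots,x_n=y$ and times $t_i\ge \tau$ with $d(\phi^{t_i}(x_i),x_{i+1})<\varepsilon(\phi^{t_i}(x_i))$ for $0\le i<n$. In both cases the chain recurrent set is $\mathcal R_C=\{x: x\rightsquigarrow x\}$, and its chain transitive components are the classes of the equivalence relation "$x\rightsquigarrow y$ and $y\rightsquigarrow x$" on $\mathcal R_C$. *Complete Lyapunov functions.* A complete Lyapunov function for the semiflow is a continuous $L:X\to[0,1]$ such that 1. for $x\in\mathcal R_C$ the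 function $t\mapsto L(\phi^t(x))$ is constant; for $x\notin\mathcal R_C$ it is nonincreasing, and strictly decreasing as long as the orbit is off $\mathcal R_C$: $L(\phi^t(x))<L(\phi^s(x))$ whenever $0\le s<t$ and $\phi^s(x)\notin\mathcal R_C$; 2. $L(\mathcal R_C)$ is nowhere dense in $[0,1]$; 3. for every $c\in L(\mathcal R_C)$ the set $L^{-1}(c)\cap\mathcal R_C$ is a chain transitive component of $\mathcal R_C$. For a continuous map $T$ the definition is the same, with $n\mapsto L(T^n(x))$, $n\in\mathbb N$, in place of $t\mapsto L(\phi^t(x))$ and with the chain recurrent set and components of $T$. **Theorem.** Let $\phi^t$ be a semiflow on a metric space $X$, let $\ell:X\to[0,1]$ be a complete Lyapunov function for its time-one map $\phi^1$, and put $$L(x)=\int_0^1\ell(\phi^t(x))\,dt .$$ Then $L$ is a complete Lyapunov function for the semiflow. Moreover: - if for every $c\in\ell(\mathcal R_C(\phi^1))$ the whole level set $\ell^{-1}(c)$ is a chain transitive component for $\phi^1$, then for every $c\in L(\mathcal R_C(\phi^t))$ the whole level set $L^{-1}(c)$ is a chain transitive component for the semiflow; - if $n\mapsto\ell(\phi^n(x))$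 is strictly decreasing on all of $\mathbb N$ for every $x\notin\mathcal R_C(\phi^1)$, then $t\mapsto L(\phi^t(x))$ is strictly decreasing on all of $[0,\infty)$ for every $x\notin\mathcal R_C(\phi^t)$. Finally, if $X$ is separable, then every semiflow on $X$ has a complete Lyapunov function. -/

import Mathlib

open Set
open scoped NNReal

/-- `x` is joined to `y` by `ε`-chains of the map `T`, for every continuous positive function `ε`:
there are `n ≥ 1` and `x = x₀, x₁, …, xₙ = y` with `d(T xᵢ, xᵢ₊₁) < ε (T xᵢ)`. -/
def MapChains {X : Type*} [MetricSpace X] (T : X → X) (x y : X) : Prop :=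
  ∀ ε : X → ℝ, Continuous ε → (∀ z, 0 < ε z) →
    Relation.TransGen (fun u v => dist (T u) v < ε (T u)) x y

/-- `x` is joined to `y` by `(ε, T)`-chains of the semiflow `φ`, for every continuous positive
function `ε` and every time `T`: there are `n ≥ 1`, points `x = x₀, x₁, …, xₙ = y` and times
`tᵢ ≥ T` with `d(φ^{tᵢ} xᵢ, xᵢ₊₁) < ε (φ^{tᵢ} xᵢ)`. A semiflow is a jointly continuous action of
the additive monoid `[0, ∞)`, that is, a term of `Flow ℝ≥0 X`. -/
def SemiflowChains {X : Type*} [MetricSpace X] (φ : Flow ℝ≥0 X) (x y : X) : Prop :=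
  ∀ ε : X → ℝ, Continuous ε → (∀ z, 0 < ε z) → ∀ T : ℝ≥0, 0 < T →
    Relation.TransGen (fun u v => ∃ t : ℝ≥0, T ≤ t ∧ dist (φ t u) v < ε (φ t u)) x y

/-- The chain recurrent set attached to a relation "joined by arbitrarily fine chains". -/
def chainRecurrentSet {X : Type*} (chains : X → X → Prop) : Set X :=
  {x | chains x x}

/-- `C` is a chain transitive component of the chain recurrent set: a class of the equivalence
relation "joined by arbitrarily fine chains in both directions" on that set. -/
def IsChainComponent {X : Type*} (chains : X → X → Prop) (C : Set X) : Prop :=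
  ∃ x ∈ chainRecurrentSet chains,
    C = {y | y ∈ chainRecurrentSet chains ∧ chains x y ∧ chains y x}

/-- The requirements on a complete Lyapunov function, for a system `Φ : τ → X → X` with time set
`τ` (`ℕ` for the iterates of a map, `[0, ∞)` for a semiflow) and its chain relation `chains`. -/
structure IsCompleteLyapunovFor {τ X : Type*} [Preorder τ] [MetricSpace X] (Φ : τ → X → X)
    (chains : X → X → Prop) (L : X → ℝ) : Prop where
  continuous : Continuous L
  mem_Icc : ∀ x, L x ∈ Icc (0 : ℝ) 1
  /-- `L` is constant along the orbits of chain recurrent points. -/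
  const : ∀ x ∈ chainRecurrentSet chains, ∀ s t : τ, L (Φ s x) = L (Φ t x)
  /-- `L` never increases along the orbits of the other points ... -/
  antitone : ∀ x ∉ chainRecurrentSet chains, Antitone fun t : τ => L (Φ t x)
  /-- ... and it decreases strictly as long as such an orbit is off the chain recurrent set. -/
  strict : ∀ x ∉ chainRecurrentSet chains, ∀ s t : τ, s < t →
    Φ s x ∉ chainRecurrentSet chains → L (Φ t x) < L (Φ s x)
  /-- The values on the chain recurrent set are nowhere dense in `[0, 1]`. -/
  nowhereDense : IsNowhereDense {c : Icc (0 : ℝ) 1 | (c : ℝ) ∈ L '' chainRecurrentSet chains}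
  /-- The level sets of `L` on the chain recurrent set are the chain transitive components. -/
  level : ∀ c ∈ L '' chainRecurrentSet chains,
    IsChainComponent chains (L ⁻¹' {c} ∩ chainRecurrentSet chains)

/-- Complete Lyapunov functions of a map. -/
def IsCompleteLyapunovMap {X : Type*} [MetricSpace X] (T : X → X) (L : X → ℝ) : Prop :=
  IsCompleteLyapunovFor (fun n : ℕ => T^[n]) (MapChains T) L

/-- Complete Lyapunov functions of a semiflow. -/
def IsCompleteLyapunovSemiflow {X : Type*} [MetricSpace X] (φ : Flow ℝ≥0 X) (L : X → ℝ) : Prop :=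
  IsCompleteLyapunovFor (fun (t : ℝ≥0) x => φ t x) (SemiflowChains φ) L

/-- The average `L(x) = ∫₀¹ ℓ(φ^t(x)) dt` of a function over orbit segments of length one. -/
noncomputable def orbitAverage {X : Type*} [MetricSpace X] (φ : Flow ℝ≥0 X) (l : X → ℝ) (x : X) :
    ℝ :=
  ∫ t in (0 : ℝ)..1, l (φ t.toNNReal x)

/-!
A semiflow and its time-one map have the same chain recurrent set and the same chain transitive
components. Grouping the steps of a fine chain of the map gives a chain of the semiflow with long
times. Conversely, a chain of the semiflow with integral total duration can be shadowed by a chain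
of the time-one map, and the duration of a chain ending at a recurrent point `y` becomes integral
after enough loops at `y`, each followed by a small drift along the orbit of `y`.

The decrease of `L` along an orbit is the integral of the decrease of `ℓ` under `φ¹`, and the two
functions agree on the chain recurrent set; so `L` inherits the properties of `ℓ`.

For the existence of `ℓ`, the points reached from `x` by fine chains form an attractor block of
`φ¹` (Conley), and a Urysohn function of the block separates `φ¹ x` from every point not reached
from `x`. By second countability countably many such functions suffice. They take only the values
`0` and `1` on the chain recurrent set, so the sum of their multiples by `2 / 3ⁿ⁺¹` maps this set
into the Cantor set, and the ternary digits of a value determine the component.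
-/

open Filter Relation Topology
open scoped SetRel

section Diagonal

theorem hasBasis_nhdsSet_diagonal {X : Type*} [PseudoMetricSpace X] :
    (𝓝ˢ (diagonal X)).HasBasis (fun ε : X → ℝ => Continuous ε ∧ ∀ z, 0 < ε z)
      fun ε => {p | dist p.1 p.2 < ε p.1} := by
  refine ⟨fun W => ⟨fun hW => ?_, fun ⟨ε, ⟨hε, hpos⟩, hsub⟩ => ?_⟩⟩
  · obtain ⟨O, hO, hdiag, hOW⟩ := mem_nhdsSet_iff_exists.1 hW
    rcases (Oᶜ).eq_empty_or_nonempty with hOc | hOc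
    · exact ⟨1, ⟨continuous_const, fun _ => one_pos⟩,
        fun p _ => hOW (compl_empty_iff.1 hOc ▸ trivial)⟩
    refine ⟨fun z => Metric.infDist (z, z) Oᶜ, ⟨(Metric.continuous_infDist_pt _).comp (by fun_prop),
      fun z => (hO.isClosed_compl.notMem_iff_infDist_pos hOc).1 fun h => h (hdiag rfl)⟩,
      fun p (hp : dist p.1 p.2 < _) => hOW (by_contra fun h => hp.not_ge ?_)⟩
    simpa [Prod.dist_eq] using Metric.infDist_le_dist_of_mem (x := (p.1, p.1)) (mem_compl h)
  · exact mem_nhdsSet_iff_exists.2 ⟨_, isOpen_lt continuous_dist (hε.comp continuous_fst),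
      diagonal_subset_iff.2 fun z => by simpa using hpos z, hsub⟩

theorem exists_mem_nhdsSet_diagonal_comp_subset {X : Type*} [PseudoMetricSpace X]
    {W : Set (X × X)} (hW : W ∈ 𝓝ˢ (diagonal X)) : ∃ V ∈ 𝓝ˢ (diagonal X), V ○ V ⊆ W := by
  obtain ⟨ε, ⟨hε, hpos⟩, hεW⟩ := hasBasis_nhdsSet_diagonal.mem_iff.1 hW
  refine ⟨{p | dist p.1 p.2 < ε p.1 / 4} ∩ {p | ε p.2 < 2 * ε p.1}, inter_mem
    (hasBasis_nhdsSet_diagonal.mem_of_mem ⟨hε.div_const 4, fun z => by linarith [hpos z]⟩) ?_, ?_⟩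
  · exact (isOpen_lt (by fun_prop) (by fun_prop)).mem_nhdsSet.2
      (diagonal_subset_iff.2 fun z => lt_two_mul_self (hpos z))
  · rintro ⟨x, z⟩ ⟨y, ⟨hxy, hε_xy⟩, hyz, -⟩
    simp only [mem_ofPred_eq] at hxy hyz hε_xy
    exact hεW (show dist x z < ε x by linarith [dist_triangle x y z, hpos x])

variable {X : Type*} [TopologicalSpace X]

theorem preimage_mem_nhdsSet_diagonal {T : X → X} (hT : Continuous T) {W : Set (X × X)}
    (hW : W ∈ 𝓝ˢ (diagonal X)) : Prod.map T T ⁻¹' W ∈ 𝓝ˢ (diagonal X) :=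
  (hT.prodMap hT).tendsto_nhdsSet (fun _ hp => congrArg T hp) hW

theorem setOf_forall_mem_nhdsSet_diagonal {S : Type*} [TopologicalSpace S] {φ : S → X → X}
    (hφ : Continuous φ.uncurry) {K : Set S} (hK : IsCompact K) {W : Set (X × X)}
    (hW : W ∈ 𝓝ˢ (diagonal X)) :
    {p : X × X | ∀ s ∈ K, (φ s p.1, φ s p.2) ∈ W} ∈ 𝓝ˢ (diagonal X) := by
  refine mem_nhdsSet_iff_forall.2 fun p hp =>
    hK.eventually_forall_of_forall_eventually fun s _ => ?_
  have hc : Continuous fun q : (X × X) × S => (φ q.2 q.1.1, φ q.2 q.1.2) :=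
    (hφ.comp (by fun_prop : Continuous fun q : (X × X) × S => (q.2, q.1.1))).prodMk
      (hφ.comp (by fun_prop : Continuous fun q : (X × X) × S => (q.2, q.1.2)))
  exact hc.continuousAt.eventually (mem_nhdsSet_iff_forall.1 hW _ (congrArg (φ s) hp))

theorem compl_prod_mem_nhdsSet_diagonal {A B : Set X} (hA : IsClosed A) (hB : IsClosed B)
    (hAB : Disjoint A B) : (A ×ˢ B)ᶜ ∈ 𝓝ˢ (diagonal X) :=
  (hA.prod hB).isOpen_compl.mem_nhdsSet.2
    (diagonal_subset_iff.2 fun _ ⟨hzA, hzB⟩ => hAB.ne_of_mem hzA hzB rfl)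

end Diagonal

section Chains

/-- One step of a chain of the map `T`: from `u` to a point `v` that is `V`-close to `T u`. -/
def MapStep {X : Type*} (T : X → X) (V : Set (X × X)) (u v : X) : Prop :=
  (T u, v) ∈ V

/-- One step of a chain of the semiflow `φ`: from `u` to a point `v` that is `V`-close to `φ t u`
for some time `t ≥ τ`. -/
def FlowStep {X : Type*} [TopologicalSpace X] (φ : Flow ℝ≥0 X) (τ : ℝ≥0) (V : Set (X × X))
    (u v : X) : Prop :=
  ∃ t ≥ τ, (φ t u, v) ∈ V

theorem FlowStep.mono {X : Type*} [TopologicalSpace X] {φ : Flow ℝ≥0 X} {σ τ : ℝ≥0} (hτ : σ ≤ τ)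
    {V W : Set (X × X)} (hVW : V ⊆ W) {u v : X} : FlowStep φ τ V u v → FlowStep φ σ W u v :=
  fun ⟨t, ht, h⟩ => ⟨t, hτ.trans ht, hVW h⟩

variable {X : Type*} [MetricSpace X]

theorem mapChains_iff {T : X → X} {x y : X} :
    MapChains T x y ↔ ∀ W ∈ 𝓝ˢ (diagonal X), TransGen (MapStep T W) x y := by
  rw [hasBasis_nhdsSet_diagonal.forall_iff (P := fun W => TransGen (MapStep T W) x y)
    fun V W hVW => TransGen.mono (fun _ _ h => hVW h) x y]
  exact forall_congr' fun ε => and_imp.symm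

theorem semiflowChains_iff {φ : Flow ℝ≥0 X} {x y : X} :
    SemiflowChains φ x y ↔
      ∀ W ∈ 𝓝ˢ (diagonal X), ∀ τ > 0, TransGen (FlowStep φ τ W) x y := by
  rw [hasBasis_nhdsSet_diagonal.forall_iff fun V W hVW h τ hτ =>
    TransGen.mono (fun _ _ => FlowStep.mono le_rfl hVW) x y (h τ hτ)]
  exact forall_congr' fun ε => and_imp.symm

theorem MapChains.trans {T : X → X} {x y z : X} (h : MapChains T x y) (h' : MapChains T y z) :
    MapChains T x z :=
  fun ε hε hpos => (h ε hε hpos).trans (h' ε hε hpos)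

theorem SemiflowChains.trans {φ : Flow ℝ≥0 X} {x y z : X} (h : SemiflowChains φ x y)
    (h' : SemiflowChains φ y z) : SemiflowChains φ x z :=
  fun ε hε hpos T hT => (h ε hε hpos T hT).trans (h' ε hε hpos T hT)

theorem MapChains.apply_right (T : X → X) (x : X) : MapChains T x (T x) :=
  fun ε _ hpos => .single (by simpa using hpos (T x))

/-- Two steps `x → x₁ → x₂` of a finer chain from `x` to itself make up one step `T x → x₂`. -/
theorem MapChains.apply_left {T : X → X} (hT : Continuous T) {x : X} (h : MapChains T x x) :
    MapChains T (T x) x := by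
  rw [mapChains_iff] at h ⊢
  intro W hW
  obtain ⟨V, hV, hVW⟩ := exists_mem_nhdsSet_diagonal_comp_subset hW
  have hsub : V ∩ Prod.map T T ⁻¹' V ⊆ W := fun p hp =>
    hVW ⟨p.1, subset_of_mem_nhdsSet hV rfl, hp.1⟩
  have hloop := h _ (inter_mem hV (preimage_mem_nhdsSet_diagonal hT hV))
  obtain ⟨x₁, hx₁, h₁⟩ := TransGen.head'_iff.1 hloop
  obtain ⟨x₂, hx₂, h₂⟩ := TransGen.head'_iff.1 (TransGen.trans_right h₁ hloop)
  exact TransGen.head' (hVW ⟨T x₁, hx₁.2, hx₂.1⟩) (ReflTransGen.mono (fun _ _ h => hsub h) _ _ h₂)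

end Chains

section RelPow

variable {α : Type*} {r : α → α → Prop}

/-- The `n`-th power of the relation `r`: `RelPow r n x y` says that `x` is joined to `y` by
exactly `n` steps of `r`. -/
def RelPow (r : α → α → Prop) : ℕ → α → α → Prop
  | 0, x, y => x = y
  | n + 1, x, y => ∃ z, RelPow r n x z ∧ r z y

theorem relPow_add {m n : ℕ} {x z : α} :
    RelPow r (m + n) x z ↔ ∃ y, RelPow r m x y ∧ RelPow r n y z := by
  induction n generalizing z with
  | zero => simp [RelPow]
  | succ n ih =>
    simp only [RelPow]
    grind

theorem RelPow.mul_self {n : ℕ} {x : α} (h : RelPow r n x x) (k : ℕ) : RelPow r (n * k) x x := by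
  induction k with
  | zero => rfl
  | succ k ih => exact relPow_add.2 ⟨x, ih, h⟩

theorem exists_relPow_succ_of_transGen {x y : α} (h : TransGen r x y) :
    ∃ n, RelPow r (n + 1) x y := by
  induction h with
  | single h => exact ⟨0, x, rfl, h⟩
  | tail _ h ih => exact ih.imp' _ fun n hn => ⟨_, hn, h⟩

theorem RelPow.transGen_blocks {N : ℕ} (hN : 0 < N) (k : ℕ) {x y : α} (h : RelPow r (N + k) x y) :
    TransGen (fun u v => ∃ m ∈ Icc N (2 * N), RelPow r m u v) x y := by
  induction k using Nat.strong_induction_on generalizing x with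
  | _ k ih =>
    rcases lt_or_ge k N with hk | hk
    · exact .single ⟨N + k, ⟨by lia, by lia⟩, h⟩
    · obtain ⟨z, hxz, hzy⟩ := relPow_add.1 h
      refine .head ⟨N, ⟨le_rfl, by lia⟩, hxz⟩ (ih (k - N) (by lia) ?_)
      rwa [Nat.add_sub_cancel' hk]

end RelPow

section MapToSemiflow

theorem eventually_iterate_mem_of_relPow {X : Type*} [PseudoMetricSpace X] {T : X → X}
    (hT : Continuous T) (m : ℕ) {W : Set (X × X)} (hW : W ∈ 𝓝ˢ (diagonal X)) :
    ∀ᶠ V in (𝓝ˢ (diagonal X)).smallSets,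
      ∀ x y, RelPow (MapStep T V) m x y → (T^[m] x, y) ∈ W := by
  induction m generalizing W with
  | zero =>
    refine .of_forall ?_
    rintro V x _ rfl
    exact subset_of_mem_nhdsSet hW rfl
  | succ m ih =>
    obtain ⟨V₁, hV₁, hVW⟩ := exists_mem_nhdsSet_diagonal_comp_subset hW
    filter_upwards [ih (preimage_mem_nhdsSet_diagonal hT hV₁), eventually_smallSets_subset.2 hV₁]
      with V hshadow hVV₁ x y ⟨z, hxz, hzy⟩
    rw [Function.iterate_succ_apply']
    exact hVW ⟨T z, hshadow x z hxz, hVV₁ hzy⟩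

variable {X : Type*} [MetricSpace X] {φ : Flow ℝ≥0 X} {x y : X}

theorem flow_one_iterate (φ : Flow ℝ≥0 X) (n : ℕ) (x : X) : (φ 1)^[n] x = φ n x := by
  induction n with
  | zero => simp
  | succ n ih => rw [Function.iterate_succ_apply', ih, ← φ.map_add, Nat.cast_succ, add_comm]

theorem MapChains.semiflowChains (h : MapChains (φ 1) x y) (hy : MapChains (φ 1) y y) :
    SemiflowChains φ x y := by
  rw [mapChains_iff] at h hy
  refine semiflowChains_iff.2 fun W hW τ hτ => ?_
  obtain ⟨N, hN⟩ := exists_nat_ge τ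
  have hN0 : 0 < N := by exact_mod_cast hτ.trans_le hN
  have hev := (eventually_all_finite (finite_Icc N (2 * N))).2 fun m _ =>
    eventually_iterate_mem_of_relPow (φ.continuous_toFun 1) m hW
  obtain ⟨V, hV, hshadow⟩ := hev.exists_mem_of_smallSets
  obtain ⟨m, hm⟩ := exists_relPow_succ_of_transGen (h V hV)
  obtain ⟨n, hn⟩ := exists_relPow_succ_of_transGen (hy V hV)
  have hlong : RelPow (MapStep (φ 1) V) (N + (m + 1 + n * N)) x y := by
    convert relPow_add.2 ⟨y, hm, hn.mul_self N⟩ using 1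
    ring
  refine TransGen.mono ?_ _ _ (hlong.transGen_blocks hN0)
  rintro u v ⟨k, hk, huv⟩
  exact ⟨k, hN.trans (by exact_mod_cast hk.1), flow_one_iterate φ k u ▸ hshadow k hk u v huv⟩

end MapToSemiflow

section SemiflowToMap

namespace SemiflowChains

variable {X : Type*} [MetricSpace X] {φ : Flow ℝ≥0 X} {x y : X}

theorem flow_right (h : SemiflowChains φ x y) (s : ℝ≥0) : SemiflowChains φ x (φ s y) := by
  rw [semiflowChains_iff] at h ⊢
  intro W hW τ hτ
  obtain ⟨z, hxz, t, ht, hzy⟩ := TransGen.tail'_iff.1 <|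
    h _ (inter_mem hW (preimage_mem_nhdsSet_diagonal (φ.continuous_toFun s) hW)) τ hτ
  refine .tail' (ReflTransGen.mono (fun _ _ => FlowStep.mono le_rfl inter_subset_left) _ _ hxz)
    ⟨s + t, le_add_of_le_right ht, ?_⟩
  rw [φ.map_add]
  exact hzy.2

theorem flow_left (h : SemiflowChains φ x y) (s : ℝ≥0) : SemiflowChains φ (φ s x) y := by
  rw [semiflowChains_iff] at h ⊢
  intro W hW τ hτ
  obtain ⟨z, ⟨t, ht, hxz⟩, hzy⟩ := TransGen.head'_iff.1 <| h W hW (τ + s) (by positivity)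
  refine .head' ⟨t - s, le_tsub_of_add_le_right ht, ?_⟩
    (ReflTransGen.mono (fun _ _ => FlowStep.mono le_self_add Subset.rfl) _ _ hzy)
  rwa [← φ.map_add, tsub_add_cancel_of_le (le_add_self.trans ht)]

end SemiflowChains

/-- The class modulo one of a time, which decides whether two times differ by a number of
iterations of the time-one map. -/
noncomputable def phase : ℝ≥0 →+ UnitAddCircle :=
  (QuotientAddGroup.mk' (AddSubgroup.zmultiples (1 : ℝ))).comp NNReal.toRealHom.toAddMonoidHom

theorem exists_le_one_phase_eq (θ : UnitAddCircle) : ∃ b ≤ 1, phase b = θ := by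
  obtain ⟨b, hb, rfl⟩ : θ ∈ ((↑) : ℝ → UnitAddCircle) '' Icc 0 (0 + 1) := by
    rw [AddCircle.coe_image_Icc_eq]
    trivial
  exact ⟨⟨b, hb.1⟩, hb.2.trans_eq (zero_add 1), rfl⟩

theorem exists_natCast_add_eq_of_phase_eq {s t : ℝ≥0} (hst : s < t) (h : phase s = phase t) :
    ∃ n : ℕ, n ≠ 0 ∧ n + s = t := by
  have hsub : ((t - s : ℝ) : UnitAddCircle) = 0 := by
    rw [AddCircle.coe_sub, sub_eq_zero]
    exact h.symm
  obtain ⟨n, hn⟩ := (AddCircle.coe_eq_zero_of_pos_iff 1 one_pos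
    (sub_pos.2 (NNReal.coe_lt_coe.2 hst))).1 hsub
  have hadd : n + s = t := by
    rw [← NNReal.coe_inj]
    push_cast
    linarith [nsmul_one (A := ℝ) n]
  exact ⟨n, fun h0 => hst.ne (by simpa [h0] using hadd), hadd⟩

variable {X : Type*}

theorem transGen_mapStep_of_flow_natCast_mem [TopologicalSpace X] {φ : Flow ℝ≥0 X}
    {W : Set (X × X)} (hW : diagonal X ⊆ W) {n : ℕ} (hn : n ≠ 0) {x y : X} (h : (φ n x, y) ∈ W) :
    TransGen (MapStep (φ 1) W) x y := by
  induction n generalizing x with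
  | zero => exact absurd rfl hn
  | succ n ih =>
    rcases eq_or_ne n 0 with rfl | hn
    · exact .single (by simpa [MapStep] using h)
    · refine .head (b := φ 1 x) (hW rfl) (ih hn ?_)
      rwa [← φ.map_add, ← Nat.cast_succ]

/-- Chains of the time-one map, with steps in `W`, lead from every point `φ a x` to all points
`V`-close to `φ b y`, provided that the phases of `a` and `b` differ by `θ`. This is what a chain
of the semiflow from `x` to `y`, of total duration `θ` modulo one, provides. The times `a ≤ 2` may
exceed `1` to leave room for a drift when chains are concatenated. -/
def PhaseJoined [TopologicalSpace X] (φ : Flow ℝ≥0 X) (V W : Set (X × X)) (θ : UnitAddCircle)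
    (x y : X) : Prop :=
  ∀ a ≤ 2, ∀ b ≤ 1, phase a = phase b + θ → ∀ w, (φ b y, w) ∈ V →
    TransGen (MapStep (φ 1) W) (φ a x) w

namespace PhaseJoined

variable [TopologicalSpace X] {φ : Flow ℝ≥0 X} {V W : Set (X × X)} {θ θ' : UnitAddCircle}
  {x y z : X}

theorem of_flow_mem (hW : diagonal X ⊆ W) (hVW : V ○ V ⊆ W) {t : ℝ≥0} (ht : 3 ≤ t)
    (hxy : ∀ s ≤ 1, (φ s (φ t x), φ s y) ∈ V) : PhaseJoined φ V W (phase t) x y := by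
  intro a ha b hb hab w hw
  rw [← map_add] at hab
  have hlt : a < b + t :=
    calc a ≤ 2 := ha
      _ < 3 := by norm_num
      _ ≤ b + t := le_add_of_le_right ht
  obtain ⟨n, hn0, hn⟩ := exists_natCast_add_eq_of_phase_eq hlt hab
  refine transGen_mapStep_of_flow_natCast_mem hW hn0 ?_
  rw [← φ.map_add, hn, φ.map_add]
  exact hVW ⟨_, hxy b hb, hw⟩

theorem trans_drift (h : PhaseJoined φ V W θ x y) (h' : PhaseJoined φ V W θ' y z) {η : ℝ≥0}
    (hη : η ≤ 1) (hdrift : ∀ b ≤ 1, (φ b y, φ (b + η) y) ∈ V) :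
    PhaseJoined φ V W (θ + (θ' - phase η)) x z := by
  intro a ha c hc hac w hw
  obtain ⟨b, hb, hbθ⟩ := exists_le_one_phase_eq (phase a - θ)
  have hxy := h a ha b hb (by rw [hbθ, sub_add_cancel]) _ (hdrift b hb)
  have hyz := h' (b + η) ((add_le_add hb hη).trans_eq one_add_one_eq_two) c hc
    (by rw [map_add, hbθ, hac]; abel) w hw
  exact hxy.trans hyz

theorem trans (hV : diagonal X ⊆ V) (h : PhaseJoined φ V W θ x y)
    (h' : PhaseJoined φ V W θ' y z) : PhaseJoined φ V W (θ + θ') x z := by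
  simpa using h.trans_drift h' (η := 0) zero_le_one fun b _ => hV (by simp)

theorem add_nsmul_loop (h : PhaseJoined φ V W θ x y) (hloop : PhaseJoined φ V W θ' y y) {η : ℝ≥0}
    (hη : η ≤ 1) (hdrift : ∀ b ≤ 1, (φ b y, φ (b + η) y) ∈ V) (n : ℕ) :
    PhaseJoined φ V W (θ + n • (θ' - phase η)) x y := by
  induction n with
  | zero => simpa using h
  | succ n ih => simpa only [succ_nsmul, add_assoc] using ih.trans_drift hloop hη hdrift

end PhaseJoined

theorem exists_phaseJoined_of_transGen [TopologicalSpace X] {φ : Flow ℝ≥0 X}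
    {U V W : Set (X × X)} (hU : ∀ p ∈ U, ∀ s ≤ 1, (φ s p.1, φ s p.2) ∈ V)
    (hV : diagonal X ⊆ V) (hW : diagonal X ⊆ W) (hVW : V ○ V ⊆ W) {x y : X}
    (h : TransGen (FlowStep φ 3 U) x y) : ∃ θ, PhaseJoined φ V W θ x y := by
  induction h with
  | single h =>
    obtain ⟨t, ht, hmem⟩ := h
    exact ⟨phase t, .of_flow_mem hW hVW ht (hU _ hmem)⟩
  | tail _ h ih =>
    obtain ⟨θ, hθ⟩ := ih
    obtain ⟨t, ht, hmem⟩ := h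
    exact ⟨θ + phase t, hθ.trans hV (.of_flow_mem hW hVW ht (hU _ hmem))⟩

theorem exists_forall_flow_add_mem [TopologicalSpace X] (φ : Flow ℝ≥0 X) {V : Set (X × X)}
    (hV : V ∈ 𝓝ˢ (diagonal X)) (y : X) :
    ∃ δ > 0, ∀ η ≤ δ, ∀ b ≤ 1, (φ b y, φ (b + η) y) ∈ V := by
  have hev : ∀ᶠ η in 𝓝 (0 : ℝ≥0), ∀ b ∈ Icc (0 : ℝ≥0) 1, (φ b y, φ (b + η) y) ∈ V := by
    refine isCompact_Icc.eventually_forall_of_forall_eventually fun b _ => ?_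
    have hc : Continuous fun q : ℝ≥0 × ℝ≥0 => (φ q.2 y, φ (q.2 + q.1) y) := by fun_prop
    exact hc.continuousAt.eventually (mem_nhdsSet_iff_forall.1 hV _ (by simp))
  obtain ⟨δ, hδ, h⟩ := nhds_bot_basis_Iic.eventually_iff.1 hev
  exact ⟨δ, hδ, fun η hη b hb => h hη b ⟨zero_le, hb⟩⟩

variable [MetricSpace X] {φ : Flow ℝ≥0 X} {x y : X}

/-- Turning around a loop at `y` many times, with a small drift along the orbit each time, makes up
for the fractional part of the duration of a chain from `x` to `y`. -/
theorem SemiflowChains.mapChains (h : SemiflowChains φ x y) (hy : SemiflowChains φ y y) :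
    MapChains (φ 1) x y := by
  rw [semiflowChains_iff] at h hy
  refine mapChains_iff.2 fun W hW => ?_
  obtain ⟨V, hV, hVW⟩ := exists_mem_nhdsSet_diagonal_comp_subset hW
  have hdV := subset_of_mem_nhdsSet hV
  have hdW := subset_of_mem_nhdsSet hW
  have hUmem := setOf_forall_mem_nhdsSet_diagonal (φ := φ.toFun) φ.cont'
    (isCompact_Icc (a := (0 : ℝ≥0)) (b := 1)) hV
  set U := {p : X × X | ∀ s ∈ Icc (0 : ℝ≥0) 1, (φ s p.1, φ s p.2) ∈ V}
  have hU : ∀ p ∈ U, ∀ s ≤ 1, (φ s p.1, φ s p.2) ∈ V := fun p hp s hs => hp s ⟨zero_le, hs⟩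
  obtain ⟨σ, hσ⟩ := exists_phaseJoined_of_transGen hU hdV hdW hVW (h U hUmem 3 three_pos)
  obtain ⟨θ, hθ⟩ := exists_phaseJoined_of_transGen hU hdV hdW hVW (hy U hUmem 3 three_pos)
  obtain ⟨δ, hδ, hdrift⟩ := exists_forall_flow_add_mem φ hV y
  obtain ⟨N, hN0, hN⟩ := NNReal.exists_nat_pos_inv_lt (lt_min hδ one_pos)
  obtain ⟨c, hc, hcphase⟩ := exists_le_one_phase_eq (σ + N • θ)
  have hη : c / N ≤ min δ 1 := by
    rw [div_eq_mul_inv]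
    exact (mul_le_of_le_one_left' hc).trans hN.le
  have htotal : σ + N • (θ - phase (c / N)) = 0 := by
    rw [nsmul_sub, ← map_nsmul, nsmul_eq_mul, mul_div_cancel₀ _ (by positivity), hcphase]
    abel
  have hjoin := hσ.add_nsmul_loop hθ (hη.trans (min_le_right _ _))
    (hdrift _ (hη.trans (min_le_left _ _))) N
  rw [htotal] at hjoin
  simpa using hjoin 0 zero_le 0 zero_le (by simp) y (hdV (by simp))

theorem semiflowChains_iff_mapChains (hy : SemiflowChains φ y y) :
    SemiflowChains φ x y ↔ MapChains (φ 1) x y :=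
  ⟨fun h => h.mapChains hy, fun h => h.semiflowChains (hy.mapChains hy)⟩

theorem chainRecurrentSet_semiflowChains (φ : Flow ℝ≥0 X) :
    chainRecurrentSet (SemiflowChains φ) = chainRecurrentSet (MapChains (φ 1)) :=
  Set.ext fun _ => ⟨fun h => h.mapChains h, fun h => h.semiflowChains h⟩

theorem isChainComponent_semiflowChains_iff {C : Set X} :
    IsChainComponent (SemiflowChains φ) C ↔ IsChainComponent (MapChains (φ 1)) C := by
  unfold IsChainComponent
  rw [← chainRecurrentSet_semiflowChains]
  refine exists_congr fun x => and_congr_right fun hx => ?_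
  suffices h : ∀ y ∈ chainRecurrentSet (SemiflowChains φ),
      (SemiflowChains φ x y ∧ SemiflowChains φ y x ↔
        MapChains (φ 1) x y ∧ MapChains (φ 1) y x) by
    rw [Set.ext fun y => and_congr_right (h y)]
  exact fun y hy =>
    and_congr (semiflowChains_iff_mapChains hy) (semiflowChains_iff_mapChains hx)

theorem flow_mem_chainRecurrentSet (hx : x ∈ chainRecurrentSet (SemiflowChains φ)) (t : ℝ≥0) :
    φ t x ∈ chainRecurrentSet (SemiflowChains φ) :=
  (SemiflowChains.flow_left hx t).flow_right t

end SemiflowToMap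

section OrbitAverage

open MeasureTheory

variable {X : Type*} [MetricSpace X] {φ : Flow ℝ≥0 X} {l : X → ℝ}

theorem continuous_comp_flow_toNNReal (φ : Flow ℝ≥0 X) (hl : Continuous l) (x : X) :
    Continuous fun u : ℝ => l (φ u.toNNReal x) :=
  hl.comp (φ.continuous continuous_real_toNNReal continuous_const)

theorem intervalIntegrable_comp_flow_toNNReal (φ : Flow ℝ≥0 X) (hl : Continuous l) (x : X)
    (a b : ℝ) : IntervalIntegrable (fun u : ℝ => l (φ u.toNNReal x)) volume a b :=
  (continuous_comp_flow_toNNReal φ hl x).intervalIntegrable a b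

theorem continuous_orbitAverage (φ : Flow ℝ≥0 X) (hl : Continuous l) :
    Continuous (orbitAverage φ l) :=
  intervalIntegral.continuous_parametric_intervalIntegral_of_continuous' (μ := volume)
    (f := fun x (t : ℝ) => l (φ t.toNNReal x))
    (hl.comp (φ.continuous (continuous_real_toNNReal.comp continuous_snd) continuous_fst)) 0 1

theorem orbitAverage_mem_Icc (φ : Flow ℝ≥0 X) (hl : Continuous l)
    (h01 : ∀ x, l x ∈ Icc (0 : ℝ) 1) (x : X) : orbitAverage φ l x ∈ Icc (0 : ℝ) 1 := by
  refine ⟨intervalIntegral.integral_nonneg zero_le_one fun t _ => (h01 _).1, ?_⟩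
  calc orbitAverage φ l x ≤ ∫ _ in (0 : ℝ)..1, (1 : ℝ) :=
        intervalIntegral.integral_mono_on zero_le_one
          (intervalIntegrable_comp_flow_toNNReal φ hl x 0 1) intervalIntegrable_const
          fun t _ => (h01 _).2
    _ = 1 := by simp

theorem orbitAverage_flow (φ : Flow ℝ≥0 X) (l : X → ℝ) (s : ℝ≥0) (x : X) :
    orbitAverage φ l (φ s x) = ∫ u in (s : ℝ)..s + 1, l (φ u.toNNReal x) := by
  calc orbitAverage φ l (φ s x) = ∫ u in (0 : ℝ)..1, l (φ (u + s).toNNReal x) := by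
        refine intervalIntegral.integral_congr fun u hu => ?_
        rw [uIcc_of_le zero_le_one] at hu
        simp only [← φ.map_add, Real.toNNReal_add hu.1 s.coe_nonneg, Real.toNNReal_coe]
    _ = ∫ u in (s : ℝ)..s + 1, l (φ u.toNNReal x) := by
        rw [intervalIntegral.integral_comp_add_right (fun u => l (φ u.toNNReal x)), zero_add,
          add_comm 1]

theorem orbitAverage_flow_sub (φ : Flow ℝ≥0 X) (hl : Continuous l) (s t : ℝ≥0) (x : X) :
    orbitAverage φ l (φ s x) - orbitAverage φ l (φ t x) =
      ∫ u in (s : ℝ)..t, (l (φ u.toNNReal x) - l (φ 1 (φ u.toNNReal x))) := by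
  have hl_int := intervalIntegrable_comp_flow_toNNReal φ hl x
  have hl_int_one : ∀ a b, IntervalIntegrable (fun u : ℝ => l (φ 1 (φ u.toNNReal x))) volume a b :=
    intervalIntegrable_comp_flow_toNNReal φ (hl.comp (φ.continuous_toFun 1)) x
  have hshift : ∫ u in (s : ℝ)..t, l (φ 1 (φ u.toNNReal x)) =
      ∫ u in (s : ℝ) + 1..t + 1, l (φ u.toNNReal x) := by
    rw [← intervalIntegral.integral_comp_add_right]
    refine intervalIntegral.integral_congr fun u hu => ?_
    have hu0 : 0 ≤ u := (le_inf s.2 t.2).trans hu.1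
    simp only [← φ.map_add, Real.toNNReal_add hu0 zero_le_one, Real.toNNReal_one, add_comm]
  rw [intervalIntegral.integral_sub (hl_int _ _) (hl_int_one _ _), hshift, orbitAverage_flow,
    orbitAverage_flow,
    intervalIntegral.integral_interval_sub_interval_comm (hl_int _ _) (hl_int _ _) (hl_int _ _)]

theorem antitone_orbitAverage_flow (φ : Flow ℝ≥0 X) (hl : Continuous l)
    (hle : ∀ x, l (φ 1 x) ≤ l x) (x : X) : Antitone fun t : ℝ≥0 => orbitAverage φ l (φ t x) := by
  intro s t hst
  rw [← sub_nonneg, orbitAverage_flow_sub φ hl]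
  exact intervalIntegral.integral_nonneg hst fun u _ => sub_nonneg.2 (hle _)

theorem orbitAverage_flow_lt_of_apply_lt (φ : Flow ℝ≥0 X) (hl : Continuous l)
    (hle : ∀ x, l (φ 1 x) ≤ l x) {x : X} {s t : ℝ≥0} (hst : s < t)
    (hlt : l (φ 1 (φ s x)) < l (φ s x)) :
    orbitAverage φ l (φ t x) < orbitAverage φ l (φ s x) := by
  have hcont : Continuous fun u : ℝ => l (φ u.toNNReal x) - l (φ 1 (φ u.toNNReal x)) :=
    (continuous_comp_flow_toNNReal φ hl x).sub
      (continuous_comp_flow_toNNReal φ (hl.comp (φ.continuous_toFun 1)) x)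
  rw [← sub_pos, orbitAverage_flow_sub φ hl]
  exact intervalIntegral.integral_pos (NNReal.coe_lt_coe.2 hst) hcont.continuousOn
    (fun u _ => sub_nonneg.2 (hle _))
    ⟨s, left_mem_Icc.2 (NNReal.coe_le_coe.2 hst.le), by simpa using hlt⟩

theorem exists_pos_apply_flow_eq_orbitAverage (φ : Flow ℝ≥0 X) (hl : Continuous l) (x : X) :
    ∃ t > 0, l (φ t x) = orbitAverage φ l x := by
  obtain ⟨t, ht, h⟩ := exists_eq_interval_average zero_ne_one
    (continuous_comp_flow_toNNReal φ hl x).continuousOn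
  rw [uIoo_of_lt zero_lt_one] at ht
  rw [interval_average_eq_div, sub_zero, div_one] at h
  exact ⟨t.toNNReal, Real.toNNReal_pos.2 ht.1, h⟩

namespace IsCompleteLyapunovMap

variable {T : X → X} {x y : X}

theorem apply_le (hl : IsCompleteLyapunovMap T l) (x : X) : l (T x) ≤ l x := by
  by_cases hx : x ∈ chainRecurrentSet (MapChains T)
  · exact (hl.const x hx 1 0).le
  · exact hl.antitone x hx zero_le_one

theorem apply_lt (hl : IsCompleteLyapunovMap T l) (hx : x ∉ chainRecurrentSet (MapChains T)) :
    l (T x) < l x :=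
  hl.strict x hx 0 1 one_pos hx

theorem eq_of_chains (hl : IsCompleteLyapunovMap T l) (hxy : MapChains T x y)
    (hyx : MapChains T y x) : l y = l x := by
  have hx : x ∈ chainRecurrentSet (MapChains T) := hxy.trans hyx
  obtain ⟨z, -, hz⟩ := hl.level (l x) ⟨x, hx, rfl⟩
  obtain ⟨-, hzx, hxz⟩ := hz.subset ⟨rfl, hx⟩
  exact (hz.superset ⟨hyx.trans hxy, hzx.trans hxy, hyx.trans hxz⟩).1

theorem apply_flow_eq (hl : IsCompleteLyapunovMap (φ 1) l)
    (hx : x ∈ chainRecurrentSet (SemiflowChains φ)) (t : ℝ≥0) : l (φ t x) = l x :=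
  hl.eq_of_chains ((SemiflowChains.flow_right hx t).mapChains (flow_mem_chainRecurrentSet hx t))
    ((SemiflowChains.flow_left hx t).mapChains hx)

theorem orbitAverage_eq (hl : IsCompleteLyapunovMap (φ 1) l)
    (hx : x ∈ chainRecurrentSet (SemiflowChains φ)) : orbitAverage φ l x = l x := by
  simp [orbitAverage, hl.apply_flow_eq hx]

theorem orbitAverage_flow_lt (hl : IsCompleteLyapunovMap (φ 1) l) {s t : ℝ≥0} (hst : s < t)
    (hs : φ s x ∉ chainRecurrentSet (SemiflowChains φ)) :
    orbitAverage φ l (φ t x) < orbitAverage φ l (φ s x) :=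
  orbitAverage_flow_lt_of_apply_lt φ hl.continuous hl.apply_le hst
    (hl.apply_lt (by rwa [← chainRecurrentSet_semiflowChains]))

theorem image_orbitAverage (hl : IsCompleteLyapunovMap (φ 1) l) :
    orbitAverage φ l '' chainRecurrentSet (SemiflowChains φ) =
      l '' chainRecurrentSet (MapChains (φ 1)) := by
  rw [← chainRecurrentSet_semiflowChains]
  exact image_congr fun x hx => hl.orbitAverage_eq hx

theorem preimage_orbitAverage_inter (hl : IsCompleteLyapunovMap (φ 1) l) (c : ℝ) :
    orbitAverage φ l ⁻¹' {c} ∩ chainRecurrentSet (SemiflowChains φ) =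
      l ⁻¹' {c} ∩ chainRecurrentSet (MapChains (φ 1)) := by
  rw [← chainRecurrentSet_semiflowChains]
  ext x
  exact and_congr_left fun hx => by rw [mem_preimage, mem_preimage, hl.orbitAverage_eq hx]

theorem isCompleteLyapunovSemiflow (hl : IsCompleteLyapunovMap (φ 1) l) :
    IsCompleteLyapunovSemiflow φ (orbitAverage φ l) where
  continuous := continuous_orbitAverage φ hl.continuous
  mem_Icc := orbitAverage_mem_Icc φ hl.continuous hl.mem_Icc
  const x hx s t := by
    rw [hl.orbitAverage_eq (flow_mem_chainRecurrentSet hx s),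
      hl.orbitAverage_eq (flow_mem_chainRecurrentSet hx t), hl.apply_flow_eq hx,
      hl.apply_flow_eq hx]
  antitone x _ := antitone_orbitAverage_flow φ hl.continuous hl.apply_le x
  strict x _ s t hst hs := hl.orbitAverage_flow_lt hst hs
  nowhereDense := hl.image_orbitAverage ▸ hl.nowhereDense
  level c hc := by
    rw [hl.preimage_orbitAverage_inter, isChainComponent_semiflowChains_iff]
    exact hl.level c (hl.image_orbitAverage ▸ hc)

theorem isChainComponent_preimage_orbitAverage (hl : IsCompleteLyapunovMap (φ 1) l)
    (hlevel : ∀ c ∈ l '' chainRecurrentSet (MapChains (φ 1)),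
      IsChainComponent (MapChains (φ 1)) (l ⁻¹' {c}))
    {c : ℝ} (hc : c ∈ orbitAverage φ l '' chainRecurrentSet (SemiflowChains φ)) :
    IsChainComponent (SemiflowChains φ) (orbitAverage φ l ⁻¹' {c}) := by
  have hcomp := hl.isCompleteLyapunovSemiflow.level c hc
  suffices h : orbitAverage φ l ⁻¹' {c} ⊆ chainRecurrentSet (SemiflowChains φ) by
    rwa [inter_eq_left.2 h] at hcomp
  rintro x rfl
  by_contra hx
  obtain ⟨t, ht0, ht⟩ := exists_pos_apply_flow_eq_orbitAverage φ hl.continuous x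
  obtain ⟨z, -, hz⟩ := hlevel _ (hl.image_orbitAverage ▸ hc)
  have hrec : φ t x ∈ chainRecurrentSet (SemiflowChains φ) := by
    rw [chainRecurrentSet_semiflowChains]
    exact (hz.subset ht).1
  have hlt := hl.orbitAverage_flow_lt ht0 (by rwa [φ.map_zero_apply])
  rw [hl.orbitAverage_eq hrec, ht, φ.map_zero_apply] at hlt
  exact hlt.false

theorem strictAnti_orbitAverage_flow (hl : IsCompleteLyapunovMap (φ 1) l)
    (hanti : ∀ x ∉ chainRecurrentSet (MapChains (φ 1)), StrictAnti fun n : ℕ => l ((φ 1)^[n] x))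
    (hx : x ∉ chainRecurrentSet (SemiflowChains φ)) :
    StrictAnti fun t : ℝ≥0 => orbitAverage φ l (φ t x) := by
  intro s t hst
  refine hl.orbitAverage_flow_lt hst fun hs => ?_
  have hconst : ∀ u ≥ s, l (φ u x) = l (φ s x) := fun u hu => by
    rw [← tsub_add_cancel_of_le hu, φ.map_add, hl.apply_flow_eq hs]
  obtain ⟨n, hn⟩ := exists_nat_ge s
  have hlt := hanti x (by rwa [← chainRecurrentSet_semiflowChains]) n.lt_succ_self
  simp only [flow_one_iterate] at hlt
  rw [hconst n hn, hconst _ (hn.trans (Nat.cast_le.2 n.le_succ))] at hlt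
  exact hlt.false

end IsCompleteLyapunovMap

end OrbitAverage

section AttractorBlock

variable {X : Type*} {T : X → X} {A U : Set X} {x y : X}

/-- A Conley attractor block of the map `T`, recorded as a neighbourhood `U` together with a closed
set `A ⊆ U` into which `T` maps all of `U`. -/
structure IsAttractorBlock [TopologicalSpace X] (T : X → X) (A U : Set X) : Prop where
  isClosed : IsClosed A
  isOpen : IsOpen U
  subset : A ⊆ U
  mapsTo : MapsTo T U A

theorem isAttractorBlock_reachable [TopologicalSpace X] (T : X → X) {W : Set (X × X)}
    (hW : IsOpen W) (hdiag : diagonal X ⊆ W) (x : X) :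
    IsAttractorBlock T (closure (T '' {z | ReflTransGen (MapStep T W) x z}))
      {z | TransGen (MapStep T W) x z} where
  isClosed := isClosed_closure
  isOpen := isOpen_iff_mem_nhds.2 fun z hz => by
    obtain ⟨w, hxw, hwz⟩ := TransGen.tail'_iff.1 hz
    filter_upwards [(hW.preimage (Continuous.prodMk_right (T w))).mem_nhds hwz] with z' hz'
    exact .tail' hxw hz'
  subset z hz := by
    obtain ⟨-, hwz, w, hxw, rfl⟩ := mem_closure_iff_nhds.1 hz _
      ((hW.preimage (Continuous.prodMk_left z)).mem_nhds (hdiag rfl))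
    exact .tail' hxw hwz
  mapsTo z hz := subset_closure (mem_image_of_mem T hz.to_reflTransGen)

theorem IsAttractorBlock.mem_of_chains [MetricSpace X] (h : IsAttractorBlock T A U) (hx : x ∈ U)
    (hxy : MapChains T x y) : y ∈ A := by
  by_contra hy
  have hdisj : Disjoint A (insert y Uᶜ) :=
    disjoint_insert_right.2 ⟨hy, disjoint_compl_right_iff_subset.2 h.subset⟩
  have hstep : ∀ {u v}, u ∈ U → MapStep T (A ×ˢ insert y Uᶜ)ᶜ u v → v ∈ U ∧ v ≠ y := by
    intro u v hu huv
    have hv : v ∉ insert y Uᶜ := fun hv => huv ⟨h.mapsTo hu, hv⟩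
    simpa [and_comm] using hv
  have hreach : ∀ {v}, TransGen (MapStep T (A ×ˢ insert y Uᶜ)ᶜ) x v → v ∈ U ∧ v ≠ y := by
    intro v hv
    induction hv with
    | single huv => exact hstep hx huv
    | tail _ huv ih => exact hstep ih.1 huv
  have hclosed : IsClosed (insert y Uᶜ) := isClosed_singleton.union h.isOpen.isClosed_compl
  exact (hreach (mapChains_iff.1 hxy _
    (compl_prod_mem_nhdsSet_diagonal h.isClosed hclosed hdisj))).2 rfl

end AttractorBlock

section BinaryLyapunov

variable {X : Type*} [MetricSpace X] {T : X → X} {x y : X}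

/-- Continuous functions with values in `[0, 1]` that do not increase along chains and take only
the values `0` and `1` on the chain recurrent set: the building blocks of a complete Lyapunov
function. -/
structure IsBinaryLyapunov (T : X → X) (k : X → ℝ) : Prop where
  continuous : Continuous k
  mem_Icc : ∀ x, k x ∈ Icc (0 : ℝ) 1
  le_of_chains : ∀ {x y}, MapChains T x y → k y ≤ k x
  eq_zero_or_one : ∀ {x}, MapChains T x x → k x = 0 ∨ k x = 1

theorem isBinaryLyapunov_zero (T : X → X) : IsBinaryLyapunov T 0 :=
  ⟨continuous_zero, fun _ => by simp, fun _ => le_rfl, fun _ => .inl rfl⟩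

theorem IsAttractorBlock.exists_isBinaryLyapunov {A U : Set X} (h : IsAttractorBlock T A U) :
    ∃ k, IsBinaryLyapunov T k ∧ (∀ x ∈ A, k x = 0) ∧ ∀ x ∉ U, k x = 1 := by
  obtain ⟨k, hkA, hkU, hk⟩ := exists_continuous_zero_one_of_isClosed h.isClosed
    h.isOpen.isClosed_compl (disjoint_compl_right_iff_subset.2 h.subset)
  refine ⟨k, ⟨k.continuous, hk, fun {x y} hxy => ?_, fun {x} hx => ?_⟩, fun x hx => hkA hx,
    fun x hx => hkU hx⟩
  · by_cases hxU : x ∈ U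
    · exact (hkA (h.mem_of_chains hxU hxy)).trans_le (hk x).1
    · exact (hk y).2.trans_eq (hkU hxU).symm
  · by_cases hxU : x ∈ U
    · exact .inl (hkA (h.mem_of_chains hxU hx))
    · exact .inr (hkU hxU)

theorem exists_isBinaryLyapunov_of_not_chains (hxy : ¬MapChains T x y) :
    ∃ k, IsBinaryLyapunov T k ∧ k (T x) < k y := by
  obtain ⟨W, hW, hWxy⟩ : ∃ W ∈ 𝓝ˢ (diagonal X), ¬TransGen (MapStep T W) x y := by
    simpa only [mapChains_iff, not_forall, exists_prop] using hxy
  obtain ⟨O, hO, hdiag, hOW⟩ := mem_nhdsSet_iff_exists.1 hW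
  obtain ⟨k, hk, hk0, hk1⟩ :=
    (isAttractorBlock_reachable T hO hdiag x).exists_isBinaryLyapunov
  refine ⟨k, hk, ?_⟩
  rw [hk0 _ (subset_closure (mem_image_of_mem T .refl)),
    hk1 y fun h => hWxy (TransGen.mono (fun _ _ huv => hOW huv) _ _ h)]
  exact zero_lt_one

theorem exists_seq_isBinaryLyapunov [SecondCountableTopology X] (hT : Continuous T) :
    ∃ k : ℕ → X → ℝ, (∀ n, IsBinaryLyapunov T (k n)) ∧
      ∀ x y, ¬MapChains T x y → ∃ n, k n (T x) < k n y := by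
  obtain ⟨K, hKsub, hK, hcover⟩ := TopologicalSpace.isOpen_biUnion_countable
    {k | IsBinaryLyapunov T k} (fun k => {p : X × X | k (T p.1) < k p.2})
    fun k hk => isOpen_lt (hk.continuous.comp (hT.comp continuous_fst))
      (hk.continuous.comp continuous_snd)
  obtain ⟨k, hk⟩ := (hK.insert 0).exists_eq_range (insert_nonempty 0 K)
  refine ⟨k, fun n => ?_, fun x y hxy => ?_⟩
  · exact insert_subset (isBinaryLyapunov_zero T) hKsub (hk ▸ mem_range_self n)
  · obtain ⟨j, hj, hlt⟩ := exists_isBinaryLyapunov_of_not_chains hxy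
    have hmem : (x, y) ∈ ⋃ k ∈ {k | IsBinaryLyapunov T k}, {p : X × X | k (T p.1) < k p.2} :=
      mem_biUnion hj hlt
    obtain ⟨i, hi, hi_lt⟩ := mem_iUnion₂.1 (hcover.superset hmem)
    obtain ⟨n, rfl⟩ := hk.subset (mem_insert_of_mem 0 hi)
    exact ⟨n, hi_lt⟩

end BinaryLyapunov

section TernarySum

variable {a b : ℕ → ℝ}

/-- The sum `∑ 2 aₙ / 3ⁿ⁺¹`. On sequences of zeros and ones it is the standard parametrization of
the Cantor set, with ternary digits `2 aₙ`. -/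
noncomputable def ternarySum (a : ℕ → ℝ) : ℝ :=
  ∑' n, 2 * a n * ((3 : ℝ) ^ (n + 1))⁻¹

theorem hasSum_two_mul_inv_three_pow : HasSum (fun n : ℕ => 2 * ((3 : ℝ) ^ (n + 1))⁻¹) 1 := by
  have h := (hasSum_geometric_of_lt_one (r := (3 : ℝ)⁻¹) (by norm_num) (by norm_num)).mul_left
    (2 / 3)
  norm_num at h
  exact h.congr_fun fun n => by simp [pow_succ]; ring

theorem ternarySum_term_mem_Icc (ha : a ∈ Icc 0 1) (n : ℕ) :
    2 * a n * ((3 : ℝ) ^ (n + 1))⁻¹ ∈ Icc 0 (2 * ((3 : ℝ) ^ (n + 1))⁻¹) := by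
  have h0 : 0 ≤ a n := ha.1 n
  have h1 : a n ≤ 1 := ha.2 n
  constructor
  · positivity
  · gcongr
    linarith

theorem summable_ternarySum (ha : a ∈ Icc 0 1) :
    Summable fun n => 2 * a n * ((3 : ℝ) ^ (n + 1))⁻¹ :=
  .of_nonneg_of_le (fun n => (ternarySum_term_mem_Icc ha n).1)
    (fun n => (ternarySum_term_mem_Icc ha n).2) hasSum_two_mul_inv_three_pow.summable

theorem ternarySum_mem_Icc (ha : a ∈ Icc 0 1) : ternarySum a ∈ Icc (0 : ℝ) 1 :=
  ⟨tsum_nonneg fun n => (ternarySum_term_mem_Icc ha n).1,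
    hasSum_two_mul_inv_three_pow.tsum_eq ▸ (summable_ternarySum ha).tsum_le_tsum
      (fun n => (ternarySum_term_mem_Icc ha n).2) hasSum_two_mul_inv_three_pow.summable⟩

theorem strictMonoOn_ternarySum : StrictMonoOn ternarySum (Icc 0 1) := by
  intro a ha b hb hab
  obtain ⟨hle, n, hn⟩ := Pi.lt_def.1 hab
  refine Summable.tsum_lt_tsum (i := n) (fun m => ?_) ?_ (summable_ternarySum ha)
    (summable_ternarySum hb)
  · have := hle m
    dsimp only
    gcongr
  · gcongr

theorem continuousOn_ternarySum : ContinuousOn ternarySum (Icc 0 1) :=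
  continuousOn_tsum (fun n => by fun_prop) hasSum_two_mul_inv_three_pow.summable fun n a ha => by
    rw [Real.norm_of_nonneg (ternarySum_term_mem_Icc ha n).1]
    exact (ternarySum_term_mem_Icc ha n).2

theorem ternarySum_eq_ofDigits (ha : ∀ n, a n = 0 ∨ a n = 1) :
    ternarySum a = Real.ofDigits fun n => if a n = 1 then (2 : Fin 3) else 0 := by
  refine tsum_congr fun n => ?_
  rcases ha n with h | h <;> simp [Real.ofDigitsTerm, h]

theorem ternarySum_mem_cantorSet (ha : ∀ n, a n = 0 ∨ a n = 1) : ternarySum a ∈ cantorSet := by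
  rw [ternarySum_eq_ofDigits ha]
  exact ofDigits_zero_two_sequence_mem_cantorSet fun n => by split_ifs <;> decide

theorem injOn_ternarySum : InjOn ternarySum {a | ∀ n, a n = 0 ∨ a n = 1} := by
  intro a ha b hb hab
  rw [ternarySum_eq_ofDigits ha, ternarySum_eq_ofDigits hb] at hab
  have hdigits := ofDigits_zero_two_sequence_unique (fun n => by split_ifs <;> decide)
    (fun n => by split_ifs <;> decide) hab
  funext n
  have hn := congrFun hdigits n
  rcases ha n with h | h <;> rcases hb n with h' | h' <;> simp_all

end TernarySum

section NowhereDense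

theorem interior_eq_empty_of_isTotallyDisconnected {α : Type*} [ConditionallyCompleteLinearOrder α]
    [DenselyOrdered α] [Nontrivial α] [TopologicalSpace α] [OrderTopology α] {s : Set α}
    (hs : IsTotallyDisconnected s) : interior s = ∅ := by
  by_contra! hne
  obtain ⟨a, b, hab, hsub⟩ := isOpen_interior.exists_Ioo_subset hne
  exact (Ioo_infinite hab).nontrivial.not_subsingleton
    (hs _ (hsub.trans interior_subset) isPreconnected_Ioo)

theorem isTotallyDisconnected_cantorSet : IsTotallyDisconnected cantorSet :=
  totallyDisconnectedSpace_subtype_iff.1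
    cantorSetHomeomorphNatToBool.symm.totallyDisconnectedSpace

theorem isNowhereDense_preimage_cantorSet :
    IsNowhereDense ((↑) ⁻¹' cantorSet : Set (Icc (0 : ℝ) 1)) :=
  (isClosed_cantorSet.preimage continuous_subtype_val).isNowhereDense_iff.2 <|
    interior_eq_empty_of_isTotallyDisconnected <|
      IsEmbedding.subtypeVal.isTotallyDisconnected fun t ht =>
        isTotallyDisconnected_cantorSet t (ht.trans (image_preimage_subset _ _))

end NowhereDense

section Existence

variable {X : Type*} [MetricSpace X] {T : X → X}

theorem mapsTo_chainRecurrentSet_mapChains (hT : Continuous T) :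
    MapsTo T (chainRecurrentSet (MapChains T)) (chainRecurrentSet (MapChains T)) :=
  fun x hx => (MapChains.apply_left hT hx).trans (.apply_right T x)

theorem isCompleteLyapunovMap_of_chains (hT : Continuous T) {l : X → ℝ} (hl : Continuous l)
    (h01 : ∀ x, l x ∈ Icc (0 : ℝ) 1) (hle : ∀ x y, MapChains T x y → l y ≤ l x)
    (hlt : ∀ x, ¬MapChains T x x → l (T x) < l x)
    (hnd : IsNowhereDense {c : Icc (0 : ℝ) 1 | (c : ℝ) ∈ l '' chainRecurrentSet (MapChains T)})
    (hsep : ∀ x y, MapChains T x x → MapChains T y y → l x = l y → MapChains T x y) :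
    IsCompleteLyapunovMap T l := by
  have hanti : ∀ x, Antitone fun n : ℕ => l (T^[n] x) := fun x =>
    antitone_nat_of_succ_le fun n => by
      simpa only [Function.iterate_succ_apply'] using hle _ _ (.apply_right T _)
  have hconst : ∀ x ∈ chainRecurrentSet (MapChains T), ∀ n, l (T^[n] x) = l x := by
    intro x hx n
    induction n with
    | zero => rfl
    | succ n ih =>
      have hrec := (mapsTo_chainRecurrentSet_mapChains hT).iterate n hx
      rw [Function.iterate_succ_apply', ← ih]
      exact (hle _ _ (.apply_right T _)).antisymm (hle _ _ (.apply_left hT hrec))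
  exact
  { continuous := hl
    mem_Icc := h01
    const x hx s t := (hconst x hx s).trans (hconst x hx t).symm
    antitone x _ := hanti x
    strict x _ s t hst hs := (hanti x (Nat.succ_le_of_lt hst)).trans_lt <| by
      simpa only [Function.iterate_succ_apply'] using hlt _ hs
    nowhereDense := hnd
    level := by
      rintro _ ⟨x, hx, rfl⟩
      refine ⟨x, hx, Set.ext fun y => ⟨fun ⟨hyx, hy⟩ => ?_, fun ⟨hy, hxy, hyx⟩ => ?_⟩⟩
      · exact ⟨hy, hsep x y hx hy hyx.symm, hsep y x hy hx hyx⟩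
      · exact ⟨(hle x y hxy).antisymm (hle y x hyx), hy⟩ }

theorem isCompleteLyapunovMap_ternarySum (hT : Continuous T) {k : ℕ → X → ℝ}
    (hk : ∀ n, IsBinaryLyapunov T (k n))
    (hsep : ∀ x y, ¬MapChains T x y → ∃ n, k n (T x) < k n y) :
    IsCompleteLyapunovMap T fun x => ternarySum fun n => k n x := by
  have hk01 : ∀ x, (fun n => k n x) ∈ Icc (0 : ℕ → ℝ) 1 := fun x =>
    ⟨fun n => ((hk n).mem_Icc x).1, fun n => ((hk n).mem_Icc x).2⟩
  have hle : ∀ {x y}, MapChains T x y → (fun n => k n y) ≤ fun n => k n x :=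
    fun hxy n => (hk n).le_of_chains hxy
  refine isCompleteLyapunovMap_of_chains hT ?_ (fun x => ternarySum_mem_Icc (hk01 x))
    (fun x y hxy => strictMonoOn_ternarySum.monotoneOn (hk01 y) (hk01 x) (hle hxy))
    (fun x hx => ?_) (isNowhereDense_preimage_cantorSet.mono ?_) fun x y hx hy hxy => ?_
  · exact continuousOn_ternarySum.comp_continuous
      (continuous_pi fun n => (hk n).continuous) hk01
  · obtain ⟨n, hn⟩ := hsep x x hx
    exact strictMonoOn_ternarySum (hk01 _) (hk01 x)
      (Pi.lt_def.2 ⟨hle (.apply_right T x), n, hn⟩)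
  · rintro c ⟨x, hx, hxc⟩
    rw [mem_preimage, ← hxc]
    exact ternarySum_mem_cantorSet fun n => (hk n).eq_zero_or_one hx
  · by_contra hnot
    obtain ⟨n, hn⟩ := hsep x y hnot
    have heq : (fun n => k n x) = fun n => k n y := injOn_ternarySum
      (fun n => (hk n).eq_zero_or_one hx) (fun n => (hk n).eq_zero_or_one hy) hxy
    exact (((hk n).le_of_chains (.apply_left hT hx)).trans_lt hn).ne (congrFun heq n)

theorem exists_isCompleteLyapunovMap [SecondCountableTopology X] (hT : Continuous T) :
    ∃ l, IsCompleteLyapunovMap T l := by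
  obtain ⟨k, hk, hsep⟩ := exists_seq_isBinaryLyapunov hT
  exact ⟨_, isCompleteLyapunovMap_ternarySum hT hk hsep⟩

end Existence

theorem theorem1p1 {X : Type*} [MetricSpace X] (φ : Flow ℝ≥0 X) :
    (∀ l : X → ℝ, IsCompleteLyapunovMap (fun x => φ 1 x) l →
      IsCompleteLyapunovSemiflow φ (orbitAverage φ l) ∧
      -- if the whole level sets of `l` are chain transitive components, so are those of `L`
      ((∀ c ∈ l '' chainRecurrentSet (MapChains fun x => φ 1 x),
          IsChainComponent (MapChains fun x => φ 1 x) (l ⁻¹' {c})) →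
        ∀ c ∈ orbitAverage φ l '' chainRecurrentSet (SemiflowChains φ),
          IsChainComponent (SemiflowChains φ) (orbitAverage φ l ⁻¹' {c})) ∧
      -- if `l` decreases strictly along whole orbits starting off the chain recurrent set,
      -- so does `L`
      ((∀ x ∉ chainRecurrentSet (MapChains fun x => φ 1 x),
          StrictAnti fun n : ℕ => l ((fun x => φ 1 x)^[n] x)) →
        ∀ x ∉ chainRecurrentSet (SemiflowChains φ),
          StrictAnti fun t : ℝ≥0 => orbitAverage φ l (φ t x))) ∧
    (TopologicalSpace.SeparableSpace X → ∃ L : X → ℝ, IsCompleteLyapunovSemiflow φ L) := by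
  refine ⟨fun l hl => ⟨hl.isCompleteLyapunovSemiflow,
    fun hlevel c hc => hl.isChainComponent_preimage_orbitAverage hlevel hc,
    fun hanti x hx => hl.strictAnti_orbitAverage_flow hanti hx⟩, fun _ => ?_⟩
  have := UniformSpace.secondCountable_of_separable X
  obtain ⟨l, hl⟩ := exists_isCompleteLyapunovMap (φ.continuous_toFun 1)
  exact ⟨_, hl.isCompleteLyapunovSemiflow⟩
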